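/- Theorem 4.2 (Strict Lyapunov function on a tube). Let $A,B\subset\mathbb R^m$ be closed $C^2$ embedded submanifolds (without boundary) whose intersection $M:=A\cap B$ is nonempty and compact, and suppose that $A$ and $B$ intersect transversally, i.e. $T_xA+T_xB=\mathbb R^m$ for every $x\in M$. Suppose further that (i) there is $\theta_0>0$ with $\angle(T_xA,T_xB)\in[\theta_0,\pi/2]$ for all $x\in M$, where $\angle$ denotes the smallest principal angle between the two subspaces after their common subspace has been split off (equal to $\pi/2$ if one of them contains the other); (ii) $A$ and $B$ have reach at least $\rho>0$ (every point at distance less than $\rho$ from the set has a unique nearest point in it), and their second fundamental forms are bounded by some $\kappa<\infty$. Let $P_A,P_B$ be the nearest-point projections (with an arbitrary choice of nearest point where it is not unique), $R_A=2P_A-\mathrm{Id}$, $v(x)=P_B(R_Ax)-P_Ax$, and for $r>0$ $$\mathcal S_r=\{x\in\mathbb R^m:\operatorname{dist}(x,A)\le r,\ \operatorname{dist}(R_Ax,B)\le r\}.$$ Then there exist $r\in(0,\rho)$, $\sigma>0$ and $\delta>0$ such that, with the tube $\mathcal T:=\mathcal S_r\cap\{x:\operatorname{dist}(x,M)<\delta\}$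 around $M$, the following hold. (a) For every solution $x(\cdot)$ of $\dot x=v(x)$ on an interval and every time $t$ of that interval with $x(t)\in\mathcal T$, the function $\tfrac12\|v(x(\cdot))\|^2$ is differentiable at $t$ (one-sidedly, if $t$ is an end point of the interval) and $$\frac{d}{dt}\Big(\tfrac12\|v(x(t))\|^2\Big)\le-\sigma\|v(x(t))\|^2 .$$ (b) For every solution $x:[0,\infty)\to\mathbb R^m$ of $\dot x=v(x)$ with $x(0)\in\mathcal T$, one has $\|v(x(t))\|\le e^{-\sigma t}\|v(x(0))\|$ for all $t\ge0$, and $\operatorname{dist}(x(t),M)\to0$ as $t\to\infty$. (c) If $\mathcal S_{r_0}$ is bounded for some $r_0\in(0,\rho)$ (for instance, if $A$ or $B$ is compact), then $\mathcal S_r\subset\{x:\operatorname{dist}(x,M)<\delta\}$, so that $\mathcal T=\mathcal S_r$ in (a) and (b). -/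

import Mathlib

open Set Filter Topology

noncomputable section

/-- `A ⊆ ℝᵐ` is a `C²` embedded submanifold (without boundary) of codimension `k`: near each of its
points it is the zero set of a `C²` submersion into `ℝᵏ`. -/
def IsC2Submanifold {m : ℕ} (k : ℕ) (A : Set (EuclideanSpace ℝ (Fin m))) : Prop :=
  ∀ p ∈ A, ∃ (U : Set (EuclideanSpace ℝ (Fin m)))
      (f : EuclideanSpace ℝ (Fin m) → EuclideanSpace ℝ (Fin k)),
    IsOpen U ∧ p ∈ U ∧ ContDiffOn ℝ 2 f U ∧
    (∀ x ∈ U, Function.Surjective (fderiv ℝ f x)) ∧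
    (∀ x ∈ U, x ∈ A ↔ f x = 0)

/-- The tangent space `T_p A`: the linear space spanned by the velocities at `p` of the curves in
`A` through `p`. (On a submanifold these velocities already form a linear space.) -/
def tangentSpaceAt {m : ℕ} (A : Set (EuclideanSpace ℝ (Fin m))) (p : EuclideanSpace ℝ (Fin m)) :
    Submodule ℝ (EuclideanSpace ℝ (Fin m)) :=
  Submodule.span ℝ {u | ∃ γ : ℝ → EuclideanSpace ℝ (Fin m),
    γ 0 = p ∧ (∀ᶠ t in 𝓝 (0 : ℝ), γ t ∈ A) ∧ HasDerivAt γ u 0}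

/-- The second fundamental form of `A` is bounded by `κ`: `‖II_p(u, u)‖ ≤ κ ‖u‖²` for all `p ∈ A`
and `u ∈ T_p A`, where `II_p(u, u)` is the component normal to `A` of the acceleration `γ''(0)` of
any `C²` curve `γ` in `A` with `γ(0) = p` and `γ'(0) = u`. Since `⟪II_p(·, ·), n⟫` is symmetric for
every normal vector `n`, this is the same as `‖II_p(u, w)‖ ≤ κ ‖u‖ ‖w‖` for all `u, w`. -/
def SecondFundamentalFormBoundedBy {m : ℕ} (A : Set (EuclideanSpace ℝ (Fin m))) (κ : ℝ) : Prop :=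
  ∀ p ∈ A, ∀ γ : ℝ → EuclideanSpace ℝ (Fin m), γ 0 = p → (∀ᶠ t in 𝓝 (0 : ℝ), γ t ∈ A) →
    ContDiffAt ℝ 2 γ 0 →
    ‖(tangentSpaceAt A p)ᗮ.starProjection (iteratedDeriv 2 γ 0)‖ ≤ κ * ‖deriv γ 0‖ ^ 2

/-- The angle `∠(V, W) ∈ [0, π/2]` between two subspaces: the smallest principal angle after the
common subspace `V ∩ W` has been split off (the Friedrichs angle, which is `π/2` if one of the
spaces contains the other). -/
def subspaceAngle {m : ℕ} (V W : Submodule ℝ (EuclideanSpace ℝ (Fin m))) : ℝ :=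
  Real.arccos (sSup {c : ℝ | ∃ v ∈ V ⊓ (V ⊓ W)ᗮ, ∃ w ∈ W ⊓ (V ⊓ W)ᗮ,
    ‖v‖ ≤ 1 ∧ ‖w‖ ≤ 1 ∧ c = inner ℝ v w})

/-- `A` has reach at least `ρ` (in the sense of Federer): each point at distance less than `ρ` from
`A` has a unique nearest point in `A`. -/
def HasReachAtLeast {m : ℕ} (A : Set (EuclideanSpace ℝ (Fin m))) (ρ : ℝ) : Prop :=
  ∀ x, Metric.infDist x A < ρ → ∃! a, a ∈ A ∧ dist x a = Metric.infDist x A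

/-- The metric projection `P_A`: a nearest point of `x` in `A`, which exists if `A` is closed and
nonempty (some fixed choice of it where it is not unique). -/
def metricProj {m : ℕ} (A : Set (EuclideanSpace ℝ (Fin m))) (x : EuclideanSpace ℝ (Fin m)) :
    EuclideanSpace ℝ (Fin m) :=
  Classical.epsilon fun a => a ∈ A ∧ dist x a = Metric.infDist x A

/-- The reflector `R_A = 2 P_A - Id`. -/
def reflector {m : ℕ} (A : Set (EuclideanSpace ℝ (Fin m))) (x : EuclideanSpace ℝ (Fin m)) :
    EuclideanSpace ℝ (Fin m) :=
  (2 : ℝ) • metricProj A x - x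

/-- The RRR flow field `v(x) = P_B (R_A x) - P_A x`. -/
def rrrField {m : ℕ} (A B : Set (EuclideanSpace ℝ (Fin m))) (x : EuclideanSpace ℝ (Fin m)) :
    EuclideanSpace ℝ (Fin m) :=
  metricProj B (reflector A x) - metricProj A x

/-- `x` is a solution on the time interval `I` of the flow equation `x' = v(x)` (with one-sided
derivatives at those end points of `I` that belong to `I`). -/
def IsRRRSolutionOn {m : ℕ} (A B : Set (EuclideanSpace ℝ (Fin m)))
    (x : ℝ → EuclideanSpace ℝ (Fin m)) (I : Set ℝ) : Prop :=
  ∀ t ∈ I, HasDerivWithinAt x (rrrField A B (x t)) I t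

/-- The set `S_r = {x | dist (x, A) ≤ r, dist (R_A x, B) ≤ r}`. -/
def rrrTube {m : ℕ} (A B : Set (EuclideanSpace ℝ (Fin m))) (r : ℝ) :
    Set (EuclideanSpace ℝ (Fin m)) :=
  {x | Metric.infDist x A ≤ r ∧ Metric.infDist (reflector A x) B ≤ r}

end

/-!
The function `½ ‖v‖²` decreases along the flow near `M = A ∩ B` because of a computation at the
points of `M`. For `p ∈ M` let `Q_A`, `Q_B` be the orthogonal projections onto `T_p A`, `T_p B`, and
`K = T_p A ∩ T_p B`. The nearest-point projections are `C¹` near `p` with derivatives `Q_A`, `Q_B`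
at `p` (`contDiffAt_metricProj`, `hasFDerivAt_metricProj`), so that `v` is `C¹` near `p` with
derivative `L = Q_B (2 Q_A - 1) - Q_A` at `p`, and

  `⟪w, L w⟫ = -‖Q_A w - Q_B w‖²`   (`inner_linearField_self`).

By transversality the right-hand side is at most `-β ‖w‖²` on `Kᗮ`
(`exists_mul_norm_sq_le_of_sup_eq_top`), while it vanishes on `K`. The degenerate directions do no
harm: `L` vanishes on `K` and takes values in `Kᗮ`, and a point `x` near `p` can be written as
`x = q + y` with `q ∈ M` near `p` and `y ∈ Kᗮ`
(`eventually_exists_mem_inter_sub_mem_orthogonal`). As `v q = 0`, strict differentiability gives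
`v x = L y + o(‖y‖)`, hence `‖v x‖ ≥ c ‖y‖` and the component of `v x` in `K` is negligible compared
with `v x`. This yields both the differential inequality and `dist (x, M) ≤ C ‖v x‖` near `p`
(`exists_eventually_rrrField_estimates`), and compactness of `M` makes the constants uniform on a
neighbourhood of `M` (`exists_forall_thickening_hasRRREstimates`).

Since also `‖v x‖ ≤ 4 dist (x, M)`, a solution starting close to `M` cannot leave that neighbourhood
(`forall_mem_thickening_of_isRRRSolutionOn`); the exponential decay of `‖v‖` follows by integration,
and the convergence to `M` from `dist (x, M) ≤ C ‖v x‖`. If some `S_{r₀}` is bounded, a compactness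
argument puts a smaller `S_r` into any given neighbourhood of `M`
(`exists_rrrTube_subset_thickening`).
-/

/-! ### Nearest points -/

section NearestPoint

variable {m : ℕ} {A B : Set (EuclideanSpace ℝ (Fin m))}

lemma metricProj_spec (hA : IsClosed A) (hne : A.Nonempty) (x : EuclideanSpace ℝ (Fin m)) :
    metricProj A x ∈ A ∧ dist x (metricProj A x) = Metric.infDist x A := by
  have h : ∃ a, a ∈ A ∧ dist x a = Metric.infDist x A := by
    obtain ⟨a, ha, h⟩ := hA.exists_infDist_eq_dist hne x
    exact ⟨a, ha, h.symm⟩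
  exact Classical.epsilon_spec h

lemma dist_metricProj_le (hA : IsClosed A) (x : EuclideanSpace ℝ (Fin m))
    {y : EuclideanSpace ℝ (Fin m)} (hy : y ∈ A) : dist x (metricProj A x) ≤ dist x y := by
  rw [(metricProj_spec hA ⟨y, hy⟩ x).2]
  exact Metric.infDist_le_dist_of_mem hy

lemma metricProj_of_mem (hA : IsClosed A) {p : EuclideanSpace ℝ (Fin m)} (hp : p ∈ A) :
    metricProj A p = p := by
  have h := dist_metricProj_le hA p hp
  rw [dist_self] at h
  exact (dist_le_zero.1 h).symm

lemma reflector_of_mem (hA : IsClosed A) {p : EuclideanSpace ℝ (Fin m)} (hp : p ∈ A) :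
    reflector A p = p := by
  rw [reflector, metricProj_of_mem hA hp, two_smul, add_sub_cancel_right]

lemma rrrField_of_mem (hA : IsClosed A) (hB : IsClosed B) {p : EuclideanSpace ℝ (Fin m)}
    (hp : p ∈ A ∩ B) : rrrField A B p = 0 := by
  rw [rrrField, reflector_of_mem hA hp.1, metricProj_of_mem hA hp.1, metricProj_of_mem hB hp.2,
    sub_self]

lemma dist_reflector_metricProj (x : EuclideanSpace ℝ (Fin m)) :
    dist (reflector A x) (metricProj A x) = dist x (metricProj A x) := by
  rw [dist_comm x, dist_eq_norm, dist_eq_norm, reflector]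
  congr 1
  module

lemma norm_rrrField_le_of_mem (hA : IsClosed A) (hB : IsClosed B)
    (x : EuclideanSpace ℝ (Fin m)) {p : EuclideanSpace ℝ (Fin m)} (hp : p ∈ A ∩ B) :
    ‖rrrField A B x‖ ≤ 4 * dist x p := by
  have h1 := dist_metricProj_le hA x hp.1
  have h2 := dist_metricProj_le hB (reflector A x) hp.2
  have h3 := dist_reflector_metricProj (A := A) x
  have h4 := dist_triangle (reflector A x) (metricProj A x) p
  have h5 := dist_triangle_left (metricProj A x) p x
  have h6 := dist_triangle_left (metricProj B (reflector A x)) (metricProj A x) (reflector A x)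
  rw [rrrField, ← dist_eq_norm]
  linarith

lemma norm_rrrField_le (hA : IsClosed A) (hB : IsClosed B) (hne : (A ∩ B).Nonempty)
    (x : EuclideanSpace ℝ (Fin m)) : ‖rrrField A B x‖ ≤ 4 * Metric.infDist x (A ∩ B) := by
  obtain ⟨p, hp, h⟩ := (hA.inter hB).exists_infDist_eq_dist hne x
  rw [h]
  exact norm_rrrField_le_of_mem hA hB x hp

lemma tendsto_metricProj (hA : IsClosed A) {p : EuclideanSpace ℝ (Fin m)} (hp : p ∈ A) :
    Tendsto (metricProj A) (𝓝 p) (𝓝 p) := by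
  rw [tendsto_iff_dist_tendsto_zero]
  have h : Tendsto (fun x => 2 * dist x p) (𝓝 p) (𝓝 0) := by
    have : Continuous fun x : EuclideanSpace ℝ (Fin m) => 2 * dist x p := by fun_prop
    simpa using this.tendsto p
  refine squeeze_zero (fun _ => dist_nonneg) (fun x => ?_) h
  have h1 := dist_metricProj_le hA x hp
  have h5 := dist_triangle_left (metricProj A x) p x
  linarith

end NearestPoint

/-! ### Regularity of the nearest-point projection -/

section Regularity

variable {m k : ℕ} {A : Set (EuclideanSpace ℝ (Fin m))}

/-- The Hilbert adjoint as a real-linear map on the space of operators (Mathlib's version is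
semilinear with respect to the conjugation of `ℝ`, which keeps it out of `ContDiff`). -/
noncomputable def realAdjoint (m k : ℕ) :
    (EuclideanSpace ℝ (Fin m) →L[ℝ] EuclideanSpace ℝ (Fin k)) →L[ℝ]
      (EuclideanSpace ℝ (Fin k) →L[ℝ] EuclideanSpace ℝ (Fin m)) :=
  LinearMap.toContinuousLinearMap
    { toFun := fun T => ContinuousLinearMap.adjoint T
      map_add' := fun S T => map_add _ S T
      map_smul' := fun c T => by simp }

lemma realAdjoint_apply (T : EuclideanSpace ℝ (Fin m) →L[ℝ] EuclideanSpace ℝ (Fin k)) :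
    realAdjoint m k T = ContinuousLinearMap.adjoint T := rfl

lemma injective_realAdjoint {T : EuclideanSpace ℝ (Fin m) →L[ℝ] EuclideanSpace ℝ (Fin k)}
    (hT : Function.Surjective T) : Function.Injective (realAdjoint m k T) := by
  rw [injective_iff_map_eq_zero]
  intro l hl
  obtain ⟨h, rfl⟩ := hT l
  rw [← inner_self_eq_zero (𝕜 := ℝ), ← ContinuousLinearMap.adjoint_inner_right,
    ← realAdjoint_apply, hl, inner_zero_right]

/-- The Lagrange multiplier rule for a nearest point `a` of `x`. -/
lemma exists_realAdjoint_eq_sub {U : Set (EuclideanSpace ℝ (Fin m))}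
    {f : EuclideanSpace ℝ (Fin m) → EuclideanSpace ℝ (Fin k)} (hU : IsOpen U)
    (hf : ContDiffOn ℝ 2 f U) (hfA : ∀ x ∈ U, x ∈ A ↔ f x = 0)
    {a x : EuclideanSpace ℝ (Fin m)} (haU : a ∈ U) (haA : a ∈ A)
    (hs : Function.Surjective (fderiv ℝ f a)) (hmin : ∀ y ∈ A, dist x a ≤ dist x y) :
    ∃ l, realAdjoint m k (fderiv ℝ f a) l = x - a := by
  have hfa : HasStrictFDerivAt f (fderiv ℝ f a) a :=
    (hf.contDiffAt (hU.mem_nhds haU)).hasStrictFDerivAt (by simp)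
  have hφ : HasStrictFDerivAt (fun y => ‖y - x‖ ^ 2)
      (2 • (innerSL ℝ (a - x))) a := by
    have := (hasStrictFDerivAt_norm_sq (a - x)).comp a
      ((hasStrictFDerivAt_id (𝕜 := ℝ) a).sub_const x)
    simpa using this
  have hext : IsLocalExtrOn (fun y => ‖y - x‖ ^ 2) {y | f y = f a} a := by
    left
    have hev : ∀ᶠ y in 𝓝[{y | f y = f a}] a, y ∈ U :=
      mem_nhdsWithin_of_mem_nhds (hU.mem_nhds haU)
    filter_upwards [hev, self_mem_nhdsWithin] with y hyU hy
    have hyA : y ∈ A := (hfA y hyU).2 (by rw [hy]; exact (hfA a haU).1 haA)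
    have := hmin y hyA
    rw [dist_comm, dist_comm x y, dist_eq_norm, dist_eq_norm] at this
    gcongr
  obtain ⟨Λ, c, hne, h⟩ := hext.exists_linear_map_of_hasStrictFDerivAt hfa hφ
  -- The multiplier of the distance cannot vanish because the constraint is a submersion.
  have hc : c ≠ 0 := by
    rintro rfl
    apply hne
    have : Λ = 0 := by
      ext1 y
      obtain ⟨u, rfl⟩ := hs y
      simpa using h u
    rw [this]; rfl
  refine ⟨(1 / (2 * c)) • (InnerProductSpace.toDual ℝ _).symm Λ.toContinuousLinearMap, ?_⟩
  refine ext_inner_right ℝ fun u => ?_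
  rw [realAdjoint_apply, ContinuousLinearMap.adjoint_inner_left, real_inner_smul_left,
    InnerProductSpace.toDual_symm_apply]
  have hu := h u
  simp only [smul_apply, innerSL_apply_apply, smul_eq_mul, nsmul_eq_mul] at hu
  simp only [LinearMap.coe_toContinuousLinearMap']
  have : inner ℝ (x - a) u = - inner ℝ (a - x) u := by rw [← inner_neg_left, neg_sub]
  rw [this]
  field_simp
  push_cast at hu
  linarith

/-- The nearest-point projection onto a `C²` submanifold is `C¹` near the submanifold: the pair
(nearest point, Lagrange multiplier) is obtained from the local inverse of the `C¹` map
`(a, l) ↦ (a + Df(a)ᵀ l, f a)`. -/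
lemma contDiffAt_metricProj (hA : IsClosed A) (hman : IsC2Submanifold k A)
    {p : EuclideanSpace ℝ (Fin m)} (hp : p ∈ A) : ContDiffAt ℝ 1 (metricProj A) p := by
  obtain ⟨U, f, hU, hpU, hf, hs, hfA⟩ := hman p hp
  have hfp : ContDiffAt ℝ 2 f p := hf.contDiffAt (hU.mem_nhds hpU)
  have hDf : ContDiffAt ℝ 1 (fderiv ℝ f) p := hfp.fderiv_right (by norm_num)
  set D := fderiv ℝ f p with hD
  have hinj := injective_realAdjoint (hs p hpU)
  let Φ : EuclideanSpace ℝ (Fin m) × EuclideanSpace ℝ (Fin k) →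
      EuclideanSpace ℝ (Fin m) × EuclideanSpace ℝ (Fin k) :=
    fun z => (z.1 + realAdjoint m k (fderiv ℝ f z.1) z.2, f z.1)
  have hΦ : ContDiffAt ℝ 1 Φ (p, 0) := by
    have h1 : ContDiffAt ℝ 1 (fun z : EuclideanSpace ℝ (Fin m) × EuclideanSpace ℝ (Fin k) =>
        realAdjoint m k (fderiv ℝ f z.1)) (p, 0) :=
      (realAdjoint m k).contDiff.contDiffAt.comp (p, 0)
        (ContDiffAt.comp (g := fderiv ℝ f) (p, 0) hDf contDiffAt_fst)
    have h2 : ContDiffAt ℝ 1 (fun z : EuclideanSpace ℝ (Fin m) × EuclideanSpace ℝ (Fin k) =>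
        f z.1) (p, 0) :=
      ContDiffAt.comp (g := f) (p, 0) (hfp.of_le (by norm_num)) contDiffAt_fst
    exact (contDiffAt_fst.add (h1.clm_apply contDiffAt_snd)).prodMk h2
  let Φ' : EuclideanSpace ℝ (Fin m) × EuclideanSpace ℝ (Fin k) →L[ℝ]
      EuclideanSpace ℝ (Fin m) × EuclideanSpace ℝ (Fin k) :=
    (ContinuousLinearMap.fst ℝ _ _ + (realAdjoint m k D).comp (ContinuousLinearMap.snd ℝ _ _)).prod
      (D.comp (ContinuousLinearMap.fst ℝ _ _))
  have hΦ' : HasFDerivAt Φ Φ' (p, 0) := by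
    have hfst : HasFDerivAt (fun z : EuclideanSpace ℝ (Fin m) × EuclideanSpace ℝ (Fin k) => z.1)
        (ContinuousLinearMap.fst ℝ _ _) (p, 0) := hasFDerivAt_fst
    have h1 : HasFDerivAt (fun z : EuclideanSpace ℝ (Fin m) × EuclideanSpace ℝ (Fin k) =>
        realAdjoint m k (fderiv ℝ f z.1)) _ (p, 0) :=
      (realAdjoint m k).hasFDerivAt.comp (p, 0)
        (HasFDerivAt.comp (g := fderiv ℝ f) (p, 0)
          (hDf.differentiableAt (by simp)).hasFDerivAt hfst)
    have h2 : HasFDerivAt (fun z : EuclideanSpace ℝ (Fin m) × EuclideanSpace ℝ (Fin k) => f z.1)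
        (D.comp (ContinuousLinearMap.fst ℝ _ _)) (p, 0) :=
      HasFDerivAt.comp (g := f) (p, 0) (hfp.differentiableAt (by simp)).hasFDerivAt hfst
    have h3 := (hfst.add (h1.clm_apply hasFDerivAt_snd)).prodMk h2
    refine HasFDerivAt.congr_fderiv (f := Φ) h3 ?_
    refine ContinuousLinearMap.ext fun z => ?_
    simp [Φ', hD]
  have hker : Function.Injective Φ' := by
    rw [injective_iff_map_eq_zero]
    rintro ⟨h, l⟩ hz
    have e1 : h + realAdjoint m k D l = 0 := congrArg Prod.fst hz
    have e2 : D h = 0 := congrArg Prod.snd hz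
    have e3 : inner ℝ h (realAdjoint m k D l) = 0 := by
      rw [realAdjoint_apply, ContinuousLinearMap.adjoint_inner_right, e2, inner_zero_left]
    have e4 : h = 0 := by
      rw [← inner_self_eq_zero (𝕜 := ℝ)]
      have := congrArg (fun y => inner ℝ h y) e1
      simpa only [inner_add_right, e3, add_zero, inner_zero_right] using this
    subst e4
    rw [zero_add] at e1
    rw [hinj (e1.trans (map_zero _).symm)]
    rfl
  let Φe : (EuclideanSpace ℝ (Fin m) × EuclideanSpace ℝ (Fin k)) ≃L[ℝ]
      EuclideanSpace ℝ (Fin m) × EuclideanSpace ℝ (Fin k) :=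
    (LinearEquiv.ofInjectiveEndo (Φ' : _ →ₗ[ℝ] _) hker).toContinuousLinearEquiv
  have hΦe : HasFDerivAt Φ (Φe : _ →L[ℝ] _) (p, 0) := by
    refine hΦ'.congr_fderiv (ContinuousLinearMap.ext fun z => rfl)
  let e := hΦ.toOpenPartialHomeomorph Φ hΦe (by simp)
  have hsrc : e.source ∈ 𝓝 ((p, 0) : EuclideanSpace ℝ (Fin m) × EuclideanSpace ℝ (Fin k)) :=
    e.open_source.mem_nhds (hΦ.mem_toOpenPartialHomeomorph_source hΦe (by simp))
  have hΦp : Φ (p, 0) = (p, 0) := by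
    simp only [Φ, map_zero, add_zero, (hfA p hpU).1 hp]
  have hinv : ContDiffAt ℝ 1 e.symm
      ((p, 0) : EuclideanSpace ℝ (Fin m) × EuclideanSpace ℝ (Fin k)) := by
    have := hΦ.to_localInverse hΦe (by simp)
    rw [hΦp] at this
    exact this
  have hψ : ContDiffAt ℝ 1 (fun x : EuclideanSpace ℝ (Fin m) =>
      (e.symm (x, (0 : EuclideanSpace ℝ (Fin k)))).1) p :=
    contDiffAt_fst.comp p (ContDiffAt.comp (g := e.symm) p hinv
      (contDiffAt_id.prodMk contDiffAt_const))
  refine hψ.congr_of_eventuallyEq ?_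
  -- The multiplier of a nearest point is small when the point is close to `p`.
  obtain ⟨c, hc, hcl⟩ : ∃ c : ℝ, 0 < c ∧ ∀ l, c * ‖l‖ ≤ ‖realAdjoint m k D l‖ := by
    obtain ⟨K, hK, h⟩ := LinearMap.exists_antilipschitzWith
      (realAdjoint m k D : EuclideanSpace ℝ (Fin k) →ₗ[ℝ] EuclideanSpace ℝ (Fin m))
      (LinearMap.ker_eq_bot.2 hinj)
    refine ⟨(K : ℝ)⁻¹, by positivity, fun l => ?_⟩
    have := h.le_mul_dist l 0
    rw [map_zero, dist_zero_right, dist_zero_right] at this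
    rw [inv_mul_le_iff₀ (by positivity)]
    exact this
  have hP := tendsto_metricProj hA hp
  have hadj : Tendsto (fun x => realAdjoint m k (fderiv ℝ f (metricProj A x))) (𝓝 p)
      (𝓝 (realAdjoint m k D)) :=
    ((realAdjoint m k).continuous.tendsto _).comp (hDf.continuousAt.tendsto.comp hP)
  obtain ⟨V, hV, W, hW, hVW⟩ := mem_nhds_prod_iff.1 hsrc
  obtain ⟨ε, hε, hεW⟩ := Metric.mem_nhds_iff.1 hW
  have hsmall : ∀ᶠ x in 𝓝 p, ‖x - metricProj A x‖ < c / 2 * ε := by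
    have : Tendsto (fun x => ‖x - metricProj A x‖) (𝓝 p) (𝓝 0) := by
      simpa using (tendsto_id.sub hP).norm
    exact this.eventually (gt_mem_nhds (by positivity))
  filter_upwards [hP.eventually (hU.mem_nhds hpU), hP.eventually hV, hsmall,
    Metric.tendsto_nhds.1 hadj (c / 2) (by positivity)] with x hxU hxV hxs hxa
  have hspec := metricProj_spec hA ⟨p, hp⟩ x
  obtain ⟨l, hl⟩ := exists_realAdjoint_eq_sub hU hf hfA hxU hspec.1 (hs _ hxU)
    (fun y hy => dist_metricProj_le hA x hy)
  have hlW : l ∈ W := by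
    apply hεW
    rw [mem_ball_zero_iff]
    have h1 := hcl l
    have h2 : ‖realAdjoint m k (fderiv ℝ f (metricProj A x)) l - realAdjoint m k D l‖
        ≤ c / 2 * ‖l‖ := by
      rw [← sub_apply]
      refine (ContinuousLinearMap.le_opNorm _ _).trans ?_
      rw [dist_eq_norm] at hxa
      gcongr
    have h3 := norm_sub_norm_le (realAdjoint m k D l)
      (realAdjoint m k (fderiv ℝ f (metricProj A x)) l)
    rw [norm_sub_rev] at h3
    rw [hl] at h2 h3
    have h4 : c / 2 * ‖l‖ < c / 2 * ε := by linarith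
    exact lt_of_mul_lt_mul_left h4 (by positivity)
  have hmem : (metricProj A x, l) ∈ e.source := hVW ⟨hxV, hlW⟩
  have hΦx : e (metricProj A x, l) = (x, 0) := by
    change Φ (metricProj A x, l) = (x, 0)
    simp only [Φ, hl, (hfA _ hxU).1 hspec.1]
    rw [add_sub_cancel]
  rw [← hΦx, e.left_inv hmem]

end Regularity

/-! ### The derivative of the nearest-point projection -/

section Derivative

variable {m k : ℕ} {A B : Set (EuclideanSpace ℝ (Fin m))} {p : EuclideanSpace ℝ (Fin m)}

lemma fderiv_eq_zero_of_mem_tangentSpaceAt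
    {f : EuclideanSpace ℝ (Fin m) → EuclideanSpace ℝ (Fin k)} (hf : DifferentiableAt ℝ f p)
    (hfA : ∀ᶠ x in 𝓝 p, x ∈ A → f x = 0) {u : EuclideanSpace ℝ (Fin m)}
    (hu : u ∈ tangentSpaceAt A p) : fderiv ℝ f p u = 0 := by
  have h : tangentSpaceAt A p ≤ (fderiv ℝ f p).ker := by
    refine Submodule.span_le.2 ?_
    rintro u ⟨γ, h0, hγA, hγ⟩
    subst h0
    have h1 : HasDerivAt (f ∘ γ) (fderiv ℝ f (γ 0) u) 0 := hf.hasFDerivAt.comp_hasDerivAt 0 hγ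
    have h2 : f ∘ γ =ᶠ[𝓝 0] fun _ => 0 := by
      filter_upwards [hγA, hγ.continuousAt.eventually hfA] with t ht1 ht2 using ht2 ht1
    exact h1.unique
      ((hasDerivAt_const (0 : ℝ) (0 : EuclideanSpace ℝ (Fin k))).congr_of_eventuallyEq h2)
  exact h hu

/-- At a point `p` of `A` where the nearest-point projection is differentiable, its derivative is
the orthogonal projection onto the tangent space: it fixes the velocities of curves in `A`, takes
values in the tangent space, and `‖x - P x‖ ≤ ‖x - p‖` forces it to kill the normal vectors. -/
lemma hasFDerivAt_metricProj (hA : IsClosed A) (hp : p ∈ A)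
    (hd : DifferentiableAt ℝ (metricProj A) p) :
    HasFDerivAt (metricProj A) (tangentSpaceAt A p).starProjection p := by
  set T := tangentSpaceAt A p with hT
  set L := fderiv ℝ (metricProj A) p with hL
  have hline : ∀ u : EuclideanSpace ℝ (Fin m), HasDerivAt (fun t : ℝ => p + t • u) u 0 := by
    intro u
    simpa using ((hasDerivAt_id (0 : ℝ)).smul_const u).const_add p
  have hPline : ∀ u, HasDerivAt (fun t : ℝ => metricProj A (p + t • u)) (L u) 0 := by
    intro u
    refine HasFDerivAt.comp_hasDerivAt (x := (0 : ℝ)) (l := metricProj A) ?_ (hline u)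
    simpa using hd.hasFDerivAt
  have hrange : ∀ u, L u ∈ T := by
    intro u
    refine Submodule.subset_span ⟨fun t => metricProj A (p + t • u), ?_, ?_, hPline u⟩
    · simp [metricProj_of_mem hA hp]
    · exact Eventually.of_forall fun t => (metricProj_spec hA ⟨p, hp⟩ _).1
  have hfix : ∀ u ∈ T, L u = u := by
    have h : T ≤ (L - ContinuousLinearMap.id ℝ _).ker := by
      refine Submodule.span_le.2 ?_
      rintro u ⟨γ, h0, hγA, hγ⟩
      have h1 : HasDerivAt (metricProj A ∘ γ) (L u) 0 := by
        refine HasFDerivAt.comp_hasDerivAt (0 : ℝ) ?_ hγ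
        rw [h0]
        exact hd.hasFDerivAt
      have h2 : metricProj A ∘ γ =ᶠ[𝓝 0] γ := by
        filter_upwards [hγA] with t ht using metricProj_of_mem hA ht
      have h3 : L u = u := h1.unique (hγ.congr_of_eventuallyEq h2)
      simp [h3]
    intro u hu
    have := h hu
    simpa [sub_eq_zero] using this
  have hnormal : ∀ u ∈ Tᗮ, L u = 0 := by
    intro u hu
    have h1 : HasDerivAt (fun t : ℝ => p + t • u - metricProj A (p + t • u)) (u - L u) 0 :=
      (hline u).sub (hPline u)
    have h2 : ‖u - L u‖ ≤ ‖u‖ := by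
      refine h1.le_of_lip' (norm_nonneg u) (Eventually.of_forall fun t => ?_)
      have := dist_metricProj_le hA (p + t • u) hp
      rw [dist_eq_norm, dist_eq_norm, add_sub_cancel_left, norm_smul] at this
      simp only [zero_smul, add_zero, metricProj_of_mem hA hp, sub_self, sub_zero]
      linarith
    have h3 : ‖u - L u‖ * ‖u - L u‖ = ‖u‖ * ‖u‖ + ‖L u‖ * ‖L u‖ :=
      norm_sub_sq_eq_norm_sq_add_norm_sq_real
        (Submodule.inner_left_of_mem_orthogonal (hrange u) hu)
    have h4 : ‖u - L u‖ * ‖u - L u‖ ≤ ‖u‖ * ‖u‖ := by gcongr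
    have h5 : ‖L u‖ * ‖L u‖ = 0 := le_antisymm (by linarith) (by positivity)
    exact norm_eq_zero.1 (mul_self_eq_zero.1 h5)
  have hLT : L = T.starProjection := by
    ext1 u
    have h1 := hfix _ (Submodule.starProjection_apply_mem T u)
    have h2 := hnormal _ (Submodule.sub_starProjection_mem_orthogonal (K := T) u)
    rw [map_sub, sub_eq_zero, h1] at h2
    exact h2
  rw [← hLT]
  exact hd.hasFDerivAt

end Derivative

/-! ### The linearized flow -/

section Linear

variable {E : Type*} [NormedAddCommGroup E] [InnerProductSpace ℝ E] [FiniteDimensional ℝ E]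

/-- The linearization `Q_T (2 Q_S - 1) - Q_S` of the flow field at a common point of two
submanifolds with tangent spaces `S` and `T`, where `Q` denotes orthogonal projections. -/
noncomputable def linearField (S T : Submodule ℝ E) : E →L[ℝ] E :=
  T.starProjection.comp ((2 : ℝ) • S.starProjection - ContinuousLinearMap.id ℝ E) -
    S.starProjection

lemma linearField_apply (S T : Submodule ℝ E) (w : E) :
    linearField S T w =
      T.starProjection ((2 : ℝ) • S.starProjection w - w) - S.starProjection w := rfl

lemma inner_linearField_self (S T : Submodule ℝ E) (w : E) :
    inner ℝ w (linearField S T w) = -‖S.starProjection w - T.starProjection w‖ ^ 2 := by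
  have hS : inner ℝ w (S.starProjection w) = ‖S.starProjection w‖ ^ 2 := by
    rw [← real_inner_self_eq_norm_sq, Submodule.inner_starProjection_left_eq_right,
      Submodule.starProjection_eq_self_iff.2 (Submodule.starProjection_apply_mem S w)]
  have hT : inner ℝ w (T.starProjection w) = ‖T.starProjection w‖ ^ 2 := by
    rw [← real_inner_self_eq_norm_sq, Submodule.inner_starProjection_left_eq_right,
      Submodule.starProjection_eq_self_iff.2 (Submodule.starProjection_apply_mem T w)]
  rw [linearField_apply, map_sub, map_smul, inner_sub_right, inner_sub_right, inner_smul_right,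
    ← Submodule.inner_starProjection_left_eq_right T w (S.starProjection w), hS, hT,
    norm_sub_sq_real, real_inner_comm (S.starProjection w)]
  ring

lemma starProjection_inf_linearField (S T : Submodule ℝ E) (w : E) :
    (S ⊓ T).starProjection (linearField S T w) = 0 := by
  rw [Submodule.starProjection_apply_eq_zero_iff, Submodule.mem_orthogonal]
  intro z hz
  have hS : S.starProjection z = z := Submodule.starProjection_eq_self_iff.2 hz.1
  have hT : T.starProjection z = z := Submodule.starProjection_eq_self_iff.2 hz.2
  rw [linearField_apply, inner_sub_right, ← Submodule.inner_starProjection_left_eq_right T, hT,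
    inner_sub_right, inner_smul_right, ← Submodule.inner_starProjection_left_eq_right S, hS]
  ring

/-- Transversality makes the difference of the two projections injective on the orthogonal
complement of the common subspace. -/
lemma exists_mul_norm_sq_le_of_sup_eq_top {S T : Submodule ℝ E} (h : S ⊔ T = ⊤) :
    ∃ β : ℝ, 0 < β ∧ ∀ w ∈ (S ⊓ T)ᗮ,
      β * ‖w‖ ^ 2 ≤ ‖S.starProjection w - T.starProjection w‖ ^ 2 := by
  let F : (S ⊓ T)ᗮ →ₗ[ℝ] E :=
    ((S.starProjection - T.starProjection : E →L[ℝ] E) : E →ₗ[ℝ] E).comp (S ⊓ T)ᗮ.subtype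
  have hF : ∀ w, F w = S.starProjection (w : E) - T.starProjection (w : E) := fun w => rfl
  have hker : LinearMap.ker F = ⊥ := by
    rw [LinearMap.ker_eq_bot']
    rintro ⟨w, hw⟩ hFw
    rw [hF, sub_eq_zero] at hFw
    change S.starProjection w = T.starProjection w at hFw
    have hz : S.starProjection w ∈ S ⊓ T :=
      ⟨Submodule.starProjection_apply_mem S w, hFw ▸ Submodule.starProjection_apply_mem T w⟩
    have hS0 : S.starProjection w = 0 := by
      rw [← inner_self_eq_zero (𝕜 := ℝ), Submodule.inner_starProjection_left_eq_right,
        Submodule.starProjection_eq_self_iff.2 hz.1]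
      exact Submodule.inner_left_of_mem_orthogonal hz hw
    have hwS : w ∈ Sᗮ := (Submodule.starProjection_apply_eq_zero_iff S).1 hS0
    have hwT : w ∈ Tᗮ := (Submodule.starProjection_apply_eq_zero_iff T).1 (hFw ▸ hS0)
    have : w ∈ (S ⊔ T)ᗮ := by
      rw [← Submodule.inf_orthogonal]
      exact ⟨hwS, hwT⟩
    rw [h, Submodule.top_orthogonal_eq_bot, Submodule.mem_bot] at this
    exact Subtype.ext this
  obtain ⟨C, hC, hanti⟩ := LinearMap.exists_antilipschitzWith F hker
  refine ⟨((C : ℝ) ^ 2)⁻¹, by positivity, fun w hw => ?_⟩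
  have := hanti.le_mul_dist ⟨w, hw⟩ 0
  rw [map_zero, dist_zero_right, dist_zero_right, hF] at this
  rw [inv_mul_le_iff₀ (by positivity), ← mul_pow]
  have h' : ‖w‖ ≤ C * ‖S.starProjection w - T.starProjection w‖ := this
  gcongr

end Linear

/-! ### Estimates near a common point -/

section Local

variable {m kA kB : ℕ} {A B : Set (EuclideanSpace ℝ (Fin m))} {p : EuclideanSpace ℝ (Fin m)}

lemma contDiffAt_rrrField (hA : IsClosed A) (hB : IsClosed B) (hAman : IsC2Submanifold kA A)
    (hBman : IsC2Submanifold kB B) (hp : p ∈ A ∩ B) : ContDiffAt ℝ 1 (rrrField A B) p := by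
  have hPA := contDiffAt_metricProj hA hAman hp.1
  have hR : ContDiffAt ℝ 1 (reflector A) p := (hPA.const_smul (2 : ℝ)).sub contDiffAt_id
  have hPB : ContDiffAt ℝ 1 (metricProj B) (reflector A p) := by
    rw [reflector_of_mem hA hp.1]
    exact contDiffAt_metricProj hB hBman hp.2
  exact (hPB.comp p hR).sub hPA

lemma fderiv_rrrField (hA : IsClosed A) (hB : IsClosed B) (hAman : IsC2Submanifold kA A)
    (hBman : IsC2Submanifold kB B) (hp : p ∈ A ∩ B) :
    fderiv ℝ (rrrField A B) p = linearField (tangentSpaceAt A p) (tangentSpaceAt B p) := by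
  have hPA := hasFDerivAt_metricProj hA hp.1
    ((contDiffAt_metricProj hA hAman hp.1).differentiableAt (by simp))
  have hPB := hasFDerivAt_metricProj hB hp.2
    ((contDiffAt_metricProj hB hBman hp.2).differentiableAt (by simp))
  have hR : HasFDerivAt (reflector A)
      ((2 : ℝ) • (tangentSpaceAt A p).starProjection - ContinuousLinearMap.id ℝ _) p :=
    (hPA.const_smul (2 : ℝ)).sub (hasFDerivAt_id p)
  have hPB' : HasFDerivAt (metricProj B) (tangentSpaceAt B p).starProjection (reflector A p) := by
    rw [reflector_of_mem hA hp.1]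
    exact hPB
  exact ((hPB'.comp p hR).sub hPA).fderiv

/-- Near a point of a transversal intersection, every point `x` differs from some nearby point of
the intersection by a vector orthogonal to the fixed space `T_p A ⊓ T_p B`: the defining functions
of `A` and `B`, together with the orthogonal projection onto that space, form a submersion, hence
an open map. -/
lemma eventually_exists_mem_inter_sub_mem_orthogonal (hAman : IsC2Submanifold kA A)
    (hBman : IsC2Submanifold kB B) (hp : p ∈ A ∩ B)
    (htrans : tangentSpaceAt A p ⊔ tangentSpaceAt B p = ⊤)
    {V : Set (EuclideanSpace ℝ (Fin m))} (hV : V ∈ 𝓝 p) :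
    ∀ᶠ x in 𝓝 p, ∃ q ∈ V, q ∈ A ∩ B ∧ x - q ∈ (tangentSpaceAt A p ⊓ tangentSpaceAt B p)ᗮ := by
  obtain ⟨UA, f, hUA, hpA, hf, hsf, hfA⟩ := hAman p hp.1
  obtain ⟨UB, g, hUB, hpB, hg, hsg, hgB⟩ := hBman p hp.2
  have hUA' := hUA.mem_nhds hpA
  have hUB' := hUB.mem_nhds hpB
  have hfp := hf.contDiffAt hUA'
  have hgp := hg.contDiffAt hUB'
  have hTA : ∀ u ∈ tangentSpaceAt A p, fderiv ℝ f p u = 0 := fun u hu =>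
    fderiv_eq_zero_of_mem_tangentSpaceAt (hfp.differentiableAt (by simp))
      (by filter_upwards [hUA'] with x hx using (hfA x hx).1) hu
  have hTB : ∀ u ∈ tangentSpaceAt B p, fderiv ℝ g p u = 0 := fun u hu =>
    fderiv_eq_zero_of_mem_tangentSpaceAt (hgp.differentiableAt (by simp))
      (by filter_upwards [hUB'] with x hx using (hgB x hx).1) hu
  set K := tangentSpaceAt A p ⊓ tangentSpaceAt B p with hK
  let G : EuclideanSpace ℝ (Fin m) →
      EuclideanSpace ℝ (Fin kA) × EuclideanSpace ℝ (Fin kB) × K :=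
    fun x => (f x, g x, K.orthogonalProjectionOnto x)
  have hG : HasStrictFDerivAt G ((fderiv ℝ f p).prod
      ((fderiv ℝ g p).prod K.orthogonalProjectionOnto)) p :=
    (hfp.hasStrictFDerivAt (by simp)).prodMk
      ((hgp.hasStrictFDerivAt (by simp)).prodMk K.orthogonalProjectionOnto.hasStrictFDerivAt)
  have hsurj : ((fderiv ℝ f p).prod
      ((fderiv ℝ g p).prod K.orthogonalProjectionOnto)).range = ⊤ := by
    rw [LinearMap.range_eq_top]
    rintro ⟨a, b, k⟩
    obtain ⟨h₁, rfl⟩ := hsf p hpA a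
    obtain ⟨h₂, rfl⟩ := hsg p hpB b
    obtain ⟨u, hu, w, hw, huw⟩ := Submodule.mem_sup.1 (htrans ▸ Submodule.mem_top : h₁ - h₂ ∈ _)
    set d : K := k - K.orthogonalProjectionOnto (h₁ - u) with hd
    have h1 : h₁ - u + d = h₂ + w + d := by
      rw [show h₁ = u + w + h₂ by rw [huw]; abel]; abel
    refine ⟨h₁ - u + d, Prod.ext ?_ (Prod.ext ?_ ?_)⟩
    · change fderiv ℝ f p (h₁ - u + d) = fderiv ℝ f p h₁
      rw [map_add, map_sub, hTA u hu, hTA _ d.2.1, sub_zero, add_zero]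
    · change fderiv ℝ g p (h₁ - u + d) = fderiv ℝ g p h₂
      rw [h1, map_add, map_add, hTB w hw, hTB _ d.2.2, add_zero, add_zero]
    · change K.orthogonalProjectionOnto (h₁ - u + d) = k
      rw [map_add, Submodule.orthogonalProjectionOnto_mem_subspace_eq_self, hd,
        add_sub_cancel]
  have hopen := hG.map_nhds_eq_of_surj hsurj
  have hGp : G p = (0, 0, K.orthogonalProjectionOnto p) := by
    simp only [G, (hfA p hpA).1 hp.1, (hgB p hpB).1 hp.2]
  have himg : G '' (V ∩ (UA ∩ UB)) ∈ 𝓝 (G p) := by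
    rw [← hopen]
    exact image_mem_map (inter_mem hV (inter_mem hUA' hUB'))
  have htend : Tendsto (fun x => ((0, 0, K.orthogonalProjectionOnto x) :
      EuclideanSpace ℝ (Fin kA) × EuclideanSpace ℝ (Fin kB) × K)) (𝓝 p) (𝓝 (G p)) := by
    rw [hGp]
    exact Continuous.tendsto (by fun_prop) p
  filter_upwards [htend.eventually himg] with x hx
  obtain ⟨q, ⟨hqV, hqA, hqB⟩, hq⟩ := hx
  have e1 : f q = 0 := congrArg Prod.fst hq
  have e2 : g q = 0 := congrArg (fun z => z.2.1) hq
  have e3 : K.orthogonalProjectionOnto q = K.orthogonalProjectionOnto x :=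
    congrArg (fun z => z.2.2) hq
  refine ⟨q, hqV, ⟨(hfA q hqA).2 e1, (hgB q hqB).2 e2⟩, ?_⟩
  rw [← Submodule.orthogonalProjectionOnto_eq_zero_iff, map_sub, e3, sub_self]

/-- The local form of the theorem. Write `L` for the derivative of `v` at `p` and `K` for
`T_p A ⊓ T_p B`. With `q` in the intersection and `x - q` orthogonal to `K`, one has
`v x = L (x - q)` up to a small multiple of `‖x - q‖`; since `L` is bounded below on `Kᗮ` and takes
values in `Kᗮ`, the component of `v x` in `K`, where `⟪w, L w⟫` degenerates, is negligible. -/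
lemma exists_eventually_rrrField_estimates (hA : IsClosed A) (hB : IsClosed B)
    (hAman : IsC2Submanifold kA A) (hBman : IsC2Submanifold kB B) (hp : p ∈ A ∩ B)
    (htrans : tangentSpaceAt A p ⊔ tangentSpaceAt B p = ⊤) :
    ∃ σ : ℝ, 0 < σ ∧ ∀ᶠ x in 𝓝 p, DifferentiableAt ℝ (rrrField A B) x ∧
      inner ℝ (rrrField A B x) (fderiv ℝ (rrrField A B) x (rrrField A B x)) ≤
        -σ * ‖rrrField A B x‖ ^ 2 ∧
      σ * Metric.infDist x (A ∩ B) ≤ ‖rrrField A B x‖ := by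
  have hC1 := contDiffAt_rrrField hA hB hAman hBman hp
  have hL := fderiv_rrrField hA hB hAman hBman hp
  set v := rrrField A B with hv
  set L := linearField (tangentSpaceAt A p) (tangentSpaceAt B p) with hLdef
  set K := tangentSpaceAt A p ⊓ tangentSpaceAt B p with hK
  obtain ⟨β, hβ, hcoer⟩ := exists_mul_norm_sq_le_of_sup_eq_top htrans
  have hLcoer : ∀ w ∈ Kᗮ, inner ℝ w (L w) ≤ -(β * ‖w‖ ^ 2) := fun w hw => by
    rw [hLdef, inner_linearField_self]
    exact neg_le_neg (hcoer w hw)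
  have hLbelow : ∀ w ∈ Kᗮ, β * ‖w‖ ≤ ‖L w‖ := by
    intro w hw
    rcases (norm_nonneg w).eq_or_lt with h0 | h0
    · rw [← h0, mul_zero]; exact norm_nonneg _
    · have h1 := (abs_le.1 (abs_real_inner_le_norm w (L w))).1
      have h2 := hLcoer w hw
      refine le_of_mul_le_mul_left ?_ h0
      nlinarith
  have hLK : ∀ w, L w = L (w - K.starProjection w) := by
    intro w
    have hmem := Submodule.starProjection_apply_mem K w
    have : L (K.starProjection w) = 0 := by
      rw [hLdef, linearField_apply, Submodule.starProjection_eq_self_iff.2 hmem.1, two_smul,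
        add_sub_cancel_right, Submodule.starProjection_eq_self_iff.2 hmem.2, sub_self]
    rw [map_sub, this, sub_zero]
  have hstrict : HasStrictFDerivAt v L p := hL ▸ hC1.hasStrictFDerivAt (by simp)
  have hlittle : ∀ᶠ z : EuclideanSpace ℝ (Fin m) × EuclideanSpace ℝ (Fin m) in 𝓝 (p, p),
      ‖v z.1 - v z.2 - L (z.1 - z.2)‖ ≤ β / 4 * ‖z.1 - z.2‖ :=
    hstrict.isLittleO.def (show (0 : ℝ) < β / 4 by positivity)
  rw [nhds_prod_eq, eventually_prod_iff] at hlittle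
  obtain ⟨V₁, hV₁, V₂, hV₂, hV⟩ := hlittle
  have hdiff : ∀ᶠ x in 𝓝 p, DifferentiableAt ℝ v x :=
    (hC1.eventually (by simp)).mono fun x hx => hx.differentiableAt (by simp)
  have hcont : Tendsto (fderiv ℝ v) (𝓝 p) (𝓝 L) := by
    have h0 : ContDiffAt ℝ 0 (fderiv ℝ v) p := hC1.fderiv_right (by norm_num)
    have := h0.continuousAt.tendsto
    rwa [hL] at this
  refine ⟨β / 2, by positivity, ?_⟩
  filter_upwards [hV₁, hdiff,
    eventually_exists_mem_inter_sub_mem_orthogonal hAman hBman hp htrans hV₂,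
    Metric.tendsto_nhds.1 hcont (β / 4) (by positivity)] with x hx1 hxd ⟨q, hqV, hqM, hxq⟩ hxc
  have happrox : ‖v x - L (x - q)‖ ≤ β / 4 * ‖x - q‖ := by
    have h : ‖v x - v q - L (x - q)‖ ≤ β / 4 * ‖x - q‖ := hV hx1 hqV
    have hq : v q = 0 := rrrField_of_mem hA hB hqM
    rwa [hq, sub_zero] at h
  have hbelow : 3 / 4 * β * ‖x - q‖ ≤ ‖v x‖ := by
    have h1 := hLbelow _ hxq
    have h2 := norm_sub_norm_le (L (x - q)) (v x)
    rw [norm_sub_rev] at h2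
    linarith
  refine ⟨hxd, ?_, ?_⟩
  · set w := v x with hw
    have hcomp : ‖K.starProjection w‖ ≤ ‖w‖ / 3 := by
      have h1 : K.starProjection w = K.starProjection (w - L (x - q)) := by
        rw [map_sub, starProjection_inf_linearField, sub_zero]
      have h2 := K.norm_starProjection_apply_le (w - L (x - q))
      rw [h1]
      linarith
    have hperp : w - K.starProjection w ∈ Kᗮ :=
      Submodule.sub_starProjection_mem_orthogonal w
    have hpyth : ‖w‖ ^ 2 = ‖K.starProjection w‖ ^ 2 + ‖w - K.starProjection w‖ ^ 2 := by
      have := norm_add_sq_eq_norm_sq_add_norm_sq_real (Submodule.inner_right_of_mem_orthogonal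
        (Submodule.starProjection_apply_mem K w) hperp)
      rw [add_sub_cancel] at this
      linarith
    have hLw : inner ℝ w (L w) ≤ -(β * ‖w - K.starProjection w‖ ^ 2) := by
      have h1 : inner ℝ w (L w) =
          inner ℝ (w - K.starProjection w) (L (w - K.starProjection w)) := by
        rw [← hLK, inner_sub_left, Submodule.inner_starProjection_left_eq_right,
          starProjection_inf_linearField, inner_zero_right, sub_zero]
      rw [h1]
      exact hLcoer _ hperp
    have herr : inner ℝ w ((fderiv ℝ v x - L) w) ≤ β / 4 * ‖w‖ ^ 2 := by
      rw [dist_eq_norm] at hxc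
      calc inner ℝ w ((fderiv ℝ v x - L) w) ≤ ‖w‖ * ‖(fderiv ℝ v x - L) w‖ :=
            real_inner_le_norm _ _
        _ ≤ ‖w‖ * (β / 4 * ‖w‖) := by
            gcongr
            exact (ContinuousLinearMap.le_opNorm _ _).trans (by gcongr)
        _ = β / 4 * ‖w‖ ^ 2 := by ring
    rw [sub_apply, inner_sub_right] at herr
    have hcompsq : ‖K.starProjection w‖ ^ 2 ≤ ‖w‖ ^ 2 / 9 := by
      have : ‖K.starProjection w‖ ^ 2 ≤ (‖w‖ / 3) ^ 2 := by gcongr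
      linarith [this, (by ring : (‖w‖ / 3) ^ 2 = ‖w‖ ^ 2 / 9)]
    have hβcomp := mul_le_mul_of_nonneg_left hcompsq hβ.le
    have hβw : 0 ≤ β * ‖w‖ ^ 2 := by positivity
    rw [show ‖w - K.starProjection w‖ ^ 2 = ‖w‖ ^ 2 - ‖K.starProjection w‖ ^ 2 by linarith,
      mul_sub] at hLw
    linarith
  · have h1 := Metric.infDist_le_dist_of_mem (x := x) hqM
    rw [dist_eq_norm] at h1
    have h2 : β / 2 * Metric.infDist x (A ∩ B) ≤ β / 2 * ‖x - q‖ := by gcongr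
    have h3 : 0 ≤ β * ‖x - q‖ := by positivity
    linarith

end Local

/-! ### Uniform estimates near the intersection -/

section Uniform

variable {m kA kB : ℕ} {A B : Set (EuclideanSpace ℝ (Fin m))}

/-- The estimates at a point `x` on which the theorem rests: `v` is differentiable, the derivative of
`½ ‖v‖²` along `v` is at most `-σ ‖v‖²`, and `‖v‖` bounds the distance to the intersection. One
constant `σ` serves for both inequalities. -/
def HasRRREstimates (A B : Set (EuclideanSpace ℝ (Fin m))) (σ : ℝ)
    (x : EuclideanSpace ℝ (Fin m)) : Prop :=
  DifferentiableAt ℝ (rrrField A B) x ∧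
    inner ℝ (rrrField A B x) (fderiv ℝ (rrrField A B) x (rrrField A B x)) ≤
      -σ * ‖rrrField A B x‖ ^ 2 ∧
    σ * Metric.infDist x (A ∩ B) ≤ ‖rrrField A B x‖

lemma HasRRREstimates.mono {σ τ : ℝ} (h : τ ≤ σ) {x : EuclideanSpace ℝ (Fin m)}
    (hx : HasRRREstimates A B σ x) : HasRRREstimates A B τ x := by
  obtain ⟨h1, h2, h3⟩ := hx
  refine ⟨h1, h2.trans ?_, le_trans ?_ h3⟩
  · gcongr
  · gcongr
    exact Metric.infDist_nonneg

lemma exists_forall_thickening_hasRRREstimates (hA : IsClosed A) (hB : IsClosed B)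
    (hAman : IsC2Submanifold kA A) (hBman : IsC2Submanifold kB B) (hMcpt : IsCompact (A ∩ B))
    (htrans : ∀ p ∈ A ∩ B, tangentSpaceAt A p ⊔ tangentSpaceAt B p = ⊤) :
    ∃ σ η : ℝ, 0 < σ ∧ 0 < η ∧ ∀ x ∈ Metric.thickening η (A ∩ B), HasRRREstimates A B σ x := by
  have h : ∃ σ : ℝ, 0 < σ ∧ ∀ᶠ x in 𝓝ˢ (A ∩ B), HasRRREstimates A B σ x := by
    refine hMcpt.induction_on (p := fun s => ∃ σ : ℝ, 0 < σ ∧ ∀ᶠ x in 𝓝ˢ s,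
      HasRRREstimates A B σ x) ⟨1, one_pos, by simp⟩ ?_ ?_ ?_
    · rintro s t hst ⟨σ, hσ, h⟩
      exact ⟨σ, hσ, h.filter_mono (nhdsSet_mono hst)⟩
    · rintro s t ⟨σ, hσ, hs⟩ ⟨τ, hτ, ht⟩
      refine ⟨min σ τ, lt_min hσ hτ, ?_⟩
      rw [nhdsSet_union, eventually_sup]
      exact ⟨hs.mono fun x hx => hx.mono (min_le_left _ _),
        ht.mono fun x hx => hx.mono (min_le_right _ _)⟩
    · intro p hp
      obtain ⟨σ, hσ, h⟩ := exists_eventually_rrrField_estimates hA hB hAman hBman hp (htrans p hp)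
      refine ⟨{y | ∀ᶠ x in 𝓝 y, HasRRREstimates A B σ x},
        mem_nhdsWithin_of_mem_nhds (eventually_eventually_nhds.2 h), σ, hσ, ?_⟩
      exact eventually_nhdsSet_iff_forall.2 fun y hy => hy
  obtain ⟨σ, hσ, h⟩ := h
  obtain ⟨U, hU, hMU, hUx⟩ := eventually_nhdsSet_iff_exists.1 h
  obtain ⟨η, hη, hηU⟩ := hMcpt.exists_thickening_subset_open hU hMU
  exact ⟨σ, η, hσ, hη, fun x hx => hUx x (hηU hx)⟩

/-- On a bounded set, points that are nearly in `A` and in `B` are close to the intersection. -/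
lemma exists_rrrTube_subset_thickening (hA : IsClosed A) (hB : IsClosed B)
    (hMne : (A ∩ B).Nonempty) {r₀ δ : ℝ} (hr₀ : 0 < r₀) (hδ : 0 < δ)
    (hbdd : Bornology.IsBounded (rrrTube A B r₀)) :
    ∃ r, 0 < r ∧ r ≤ r₀ ∧ rrrTube A B r ⊆ Metric.thickening δ (A ∩ B) := by
  have hAne : A.Nonempty := hMne.mono inter_subset_left
  have hBne : B.Nonempty := hMne.mono inter_subset_right
  set S := closure (rrrTube A B r₀) ∩ (Metric.thickening δ (A ∩ B))ᶜ with hS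
  have hScpt : IsCompact S :=
    hbdd.isCompact_closure.inter_right Metric.isOpen_thickening.isClosed_compl
  have hcont : ContinuousOn (fun x => Metric.infDist x A + Metric.infDist x B) S :=
    ((Metric.continuous_infDist_pt A).add (Metric.continuous_infDist_pt B)).continuousOn
  have hpos : ∀ x ∈ S, 0 < Metric.infDist x A + Metric.infDist x B := by
    intro x hx
    have hA0 := Metric.infDist_nonneg (x := x) (s := A)
    have hB0 := Metric.infDist_nonneg (x := x) (s := B)
    refine (add_nonneg hA0 hB0).lt_of_ne fun h => hx.2 ?_
    have hxA : x ∈ A := (hA.mem_iff_infDist_zero hAne).2 (by linarith)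
    have hxB : x ∈ B := (hB.mem_iff_infDist_zero hBne).2 (by linarith)
    exact Metric.self_subset_thickening hδ _ ⟨hxA, hxB⟩
  obtain ⟨c, hc, hcS⟩ := hScpt.exists_forall_le' hcont hpos
  refine ⟨min r₀ (c / 5), by positivity, min_le_left _ _, fun x hx => ?_⟩
  by_contra hxδ
  have hxA : Metric.infDist x A ≤ c / 5 := hx.1.trans (min_le_right _ _)
  have hxB : Metric.infDist (reflector A x) B ≤ c / 5 := hx.2.trans (min_le_right _ _)
  have hxS : x ∈ S := ⟨subset_closure
    ⟨hx.1.trans (min_le_left _ _), hx.2.trans (min_le_left _ _)⟩, hxδ⟩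
  have h1 := hcS x hxS
  have h2 := Metric.infDist_le_infDist_add_dist (x := x) (y := reflector A x) (s := B)
  have h3 := dist_triangle_right x (reflector A x) (metricProj A x)
  rw [dist_reflector_metricProj, (metricProj_spec hA hAne x).2] at h3
  linarith

end Uniform

/-! ### Decay along solutions -/

section Flow

variable {m : ℕ} {A B : Set (EuclideanSpace ℝ (Fin m))}

lemma hasDerivWithinAt_half_norm_rrrField_sq {I : Set ℝ} {x : ℝ → EuclideanSpace ℝ (Fin m)}
    (hx : IsRRRSolutionOn A B x I) {t : ℝ} (ht : t ∈ I)
    (hd : DifferentiableAt ℝ (rrrField A B) (x t)) :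
    HasDerivWithinAt (fun s => (1 / 2 : ℝ) * ‖rrrField A B (x s)‖ ^ 2)
      (inner ℝ (rrrField A B (x t)) (fderiv ℝ (rrrField A B) (x t) (rrrField A B (x t)))) I t := by
  have h1 : HasDerivWithinAt (fun s => rrrField A B (x s)) _ I t :=
    hd.hasFDerivAt.comp_hasDerivWithinAt t (hx t ht)
  refine (h1.norm_sq.const_mul (1 / 2 : ℝ)).congr_deriv ?_
  ring

lemma norm_rrrField_le_exp_of_forall_mem_Icc {σ T : ℝ} {x : ℝ → EuclideanSpace ℝ (Fin m)}
    (hx : IsRRRSolutionOn A B x (Ici 0))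
    (hest : ∀ t ∈ Icc 0 T, HasRRREstimates A B σ (x t)) {t : ℝ} (ht : t ∈ Icc 0 T) :
    ‖rrrField A B (x t)‖ ≤ Real.exp (-σ * t) * ‖rrrField A B (x 0)‖ := by
  set V : ℝ → ℝ := fun s => (1 / 2 : ℝ) * ‖rrrField A B (x s)‖ ^ 2 with hV
  have hderiv : ∀ s ∈ Icc 0 T, HasDerivWithinAt V _ (Ici 0) s := fun s hs =>
    hasDerivWithinAt_half_norm_rrrField_sq hx hs.1 (hest s hs).1
  have hexp : ∀ s, HasDerivAt (fun s : ℝ => Real.exp (2 * σ * s))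
      (Real.exp (2 * σ * s) * (2 * σ)) s := fun s => by
    simpa using ((hasDerivAt_id s).const_mul (2 * σ)).exp
  have hWderiv : ∀ s ∈ interior (Icc 0 T), HasDerivAt (fun s => Real.exp (2 * σ * s) * V s) _ s :=
    fun s hs => by
      rw [interior_Icc] at hs
      exact (hexp s).mul ((hderiv s (Ioo_subset_Icc_self hs)).hasDerivAt (Ici_mem_nhds hs.1))
  have hanti : AntitoneOn (fun s => Real.exp (2 * σ * s) * V s) (Icc 0 T) := by
    refine antitoneOn_of_deriv_nonpos (convex_Icc 0 T) ?_ ?_ ?_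
    · exact fun s hs => ((hexp s).continuousAt.continuousWithinAt.mul
        ((hderiv s hs).continuousWithinAt.mono Icc_subset_Ici_self))
    · exact fun s hs => (hWderiv s hs).differentiableAt.differentiableWithinAt
    · intro s hs
      rw [(hWderiv s hs).deriv]
      have h1 := (hest s (interior_subset hs)).2.1
      have h2 : 2 * σ * V s = σ * ‖rrrField A B (x s)‖ ^ 2 := by rw [hV]; ring
      rw [mul_assoc, ← mul_add]
      refine mul_nonpos_of_nonneg_of_nonpos (Real.exp_pos _).le ?_
      linarith
  have h0 := hanti ⟨le_rfl, ht.1.trans ht.2⟩ ht ht.1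
  simp only [hV, mul_zero, Real.exp_zero, one_mul] at h0
  have h1 : (Real.exp (σ * t) * ‖rrrField A B (x t)‖) ^ 2 ≤ ‖rrrField A B (x 0)‖ ^ 2 := by
    rw [mul_pow, ← Real.exp_nat_mul, Nat.cast_ofNat, ← mul_assoc]
    linarith
  have h2 := abs_le_of_sq_le_sq h1 (norm_nonneg _)
  rw [neg_mul, Real.exp_neg, le_inv_mul_iff₀ (Real.exp_pos _)]
  exact (le_abs_self _).trans h2

/-- A solution that starts close enough to the intersection never leaves the region where the
estimates hold: until a first exit time, `‖v‖` decreases, so that the distance to the intersection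
stays below a fixed multiple of its initial value. -/
lemma forall_mem_thickening_of_isRRRSolutionOn (hA : IsClosed A) (hB : IsClosed B)
    (hMne : (A ∩ B).Nonempty) {σ η δ : ℝ} (hσ : 0 < σ) (hη : 0 < η)
    (hest : ∀ x ∈ Metric.thickening η (A ∩ B), HasRRREstimates A B σ x)
    (hδη : δ ≤ η / 2) (hδσ : 4 * δ ≤ σ * (η / 2)) {x : ℝ → EuclideanSpace ℝ (Fin m)}
    (hx : IsRRRSolutionOn A B x (Ici 0)) (hx0 : x 0 ∈ Metric.thickening δ (A ∩ B)) {t : ℝ}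
    (ht : 0 ≤ t) : x t ∈ Metric.thickening η (A ∩ B) := by
  have hmem : ∀ {ε : ℝ} {y : EuclideanSpace ℝ (Fin m)},
      y ∈ Metric.thickening ε (A ∩ B) ↔ Metric.infDist y (A ∩ B) < ε :=
    Metric.mem_thickening_iff_infDist_lt hMne
  rw [hmem] at hx0
  have hcont : ContinuousOn (fun s => Metric.infDist (x s) (A ∩ B)) (Ici 0) := fun s hs =>
    (Metric.continuous_infDist_pt (A ∩ B)).continuousAt.comp_continuousWithinAt
      (hx s hs).continuousWithinAt
  -- The exit is measured at half the radius, where the estimates still hold at the exit time.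
  set Z := Ici (0 : ℝ) ∩ (fun s => Metric.infDist (x s) (A ∩ B)) ⁻¹' Ici (η / 2) with hZ
  have hZclosed : IsClosed Z := hcont.preimage_isClosed_of_isClosed isClosed_Ici isClosed_Ici
  by_contra hcon
  rw [hmem, not_lt] at hcon
  have hZne : Z.Nonempty := ⟨t, ht, show η / 2 ≤ _ by linarith⟩
  have hZbdd : BddBelow Z := ⟨0, fun s hs => hs.1⟩
  set T := sInf Z with hT
  have hTZ : T ∈ Z := hZclosed.csInf_mem hZne hZbdd
  have hT0 : 0 ≤ T := hTZ.1
  have hbefore : ∀ s ∈ Ico 0 T, Metric.infDist (x s) (A ∩ B) ≤ η / 2 := fun s hs =>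
    le_of_not_ge fun h => notMem_of_lt_csInf hs.2 hZbdd ⟨hs.1, h⟩
  have hTne : (0 : ℝ) ≠ T := by
    intro h
    have : η / 2 ≤ Metric.infDist (x T) (A ∩ B) := hTZ.2
    rw [← h] at this
    linarith
  have hupto : ∀ s ∈ Icc 0 T, Metric.infDist (x s) (A ∩ B) ≤ η / 2 := by
    have hcl : closure (Ico 0 T) = Icc 0 T := closure_Ico hTne
    intro s hs
    have hs' : s ∈ closure (Ico 0 T) := hcl ▸ hs
    refine ((hcont s hs.1).mono (fun u hu => hu.1)).closure_le hs' continuousWithinAt_const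
      hbefore
  have hlast := norm_rrrField_le_exp_of_forall_mem_Icc hx
    (fun s hs => hest _ (hmem.2 ((hupto s hs).trans_lt (by linarith)))) (right_mem_Icc.2 hT0)
  have hexp : Real.exp (-σ * T) ≤ 1 := Real.exp_le_one_iff.2 (by nlinarith)
  have hle : ‖rrrField A B (x T)‖ ≤ ‖rrrField A B (x 0)‖ :=
    hlast.trans (mul_le_of_le_one_left (norm_nonneg _) hexp)
  have hlow := (hest (x T) (hmem.2 ((hupto T (right_mem_Icc.2 hT0)).trans_lt (by linarith)))).2.2
  have hup := norm_rrrField_le hA hB hMne (x 0)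
  have hTη : σ * (η / 2) ≤ σ * Metric.infDist (x T) (A ∩ B) := by
    have : η / 2 ≤ Metric.infDist (x T) (A ∩ B) := hTZ.2
    gcongr
  linarith

end Flow

/-! ### The Lyapunov function on the tube -/

theorem theorem4p2 {m : ℕ} (A B : Set (EuclideanSpace ℝ (Fin m)))
    (hA : IsClosed A) (hB : IsClosed B)
    (kA kB : ℕ) (hAman : IsC2Submanifold kA A) (hBman : IsC2Submanifold kB B)
    (hMne : (A ∩ B).Nonempty) (hMcpt : IsCompact (A ∩ B))
    (htrans : ∀ p ∈ A ∩ B, tangentSpaceAt A p ⊔ tangentSpaceAt B p = ⊤)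
    (θ₀ : ℝ) (hθ₀ : 0 < θ₀)
    (hangle : ∀ p ∈ A ∩ B,
      subspaceAngle (tangentSpaceAt A p) (tangentSpaceAt B p) ∈ Set.Icc θ₀ (Real.pi / 2))
    (ρ : ℝ) (hρ : 0 < ρ) (hAreach : HasReachAtLeast A ρ) (hBreach : HasReachAtLeast B ρ)
    (κ : ℝ) (hAκ : SecondFundamentalFormBoundedBy A κ)
    (hBκ : SecondFundamentalFormBoundedBy B κ) :
    ∃ r σ δ : ℝ, 0 < r ∧ r < ρ ∧ 0 < σ ∧ 0 < δ ∧
      -- if some `S_{r₀}` is bounded, then all of `S_r` is within distance `δ` of `A ∩ B`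
      ((∃ r₀, 0 < r₀ ∧ r₀ < ρ ∧ Bornology.IsBounded (rrrTube A B r₀)) →
        rrrTube A B r ⊆ Metric.thickening δ (A ∩ B)) ∧
      -- the differential inequality, at every time at which a solution is in the tube
      (∀ (I : Set ℝ) (x : ℝ → EuclideanSpace ℝ (Fin m)), I.OrdConnected →
        IsRRRSolutionOn A B x I →
        ∀ t ∈ I, x t ∈ rrrTube A B r ∩ Metric.thickening δ (A ∩ B) →
          ∃ d : ℝ,
            HasDerivWithinAt (fun s => (1 / 2 : ℝ) * ‖rrrField A B (x s)‖ ^ 2) d I t ∧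
            d ≤ -σ * ‖rrrField A B (x t)‖ ^ 2) ∧
      -- exponential decay of the gap and convergence to `A ∩ B`
      (∀ x : ℝ → EuclideanSpace ℝ (Fin m), IsRRRSolutionOn A B x (Set.Ici 0) →
        x 0 ∈ rrrTube A B r ∩ Metric.thickening δ (A ∩ B) →
          (∀ t : ℝ, 0 ≤ t →
            ‖rrrField A B (x t)‖ ≤ Real.exp (-σ * t) * ‖rrrField A B (x 0)‖) ∧
          Filter.Tendsto (fun t => Metric.infDist (x t) (A ∩ B)) Filter.atTop (nhds 0)) := by
  obtain ⟨σ, η, hσ, hη, hest⟩ :=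
    exists_forall_thickening_hasRRREstimates hA hB hAman hBman hMcpt htrans
  -- The factor `4` comes from `‖v x‖ ≤ 4 dist (x, A ∩ B)`, see `norm_rrrField_le`.
  obtain ⟨δ, hδ, hδη, hδσ⟩ : ∃ δ : ℝ, 0 < δ ∧ δ ≤ η / 2 ∧ 4 * δ ≤ σ * (η / 2) := by
    refine ⟨min (η / 2) (σ * (η / 2) / 4), by positivity, min_le_left _ _, ?_⟩
    linarith [min_le_right (η / 2) (σ * (η / 2) / 4)]
  obtain ⟨r, hr, hrρ, hbdd⟩ : ∃ r, 0 < r ∧ r < ρ ∧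
      ((∃ r₀, 0 < r₀ ∧ r₀ < ρ ∧ Bornology.IsBounded (rrrTube A B r₀)) →
        rrrTube A B r ⊆ Metric.thickening δ (A ∩ B)) := by
    by_cases h : ∃ r₀, 0 < r₀ ∧ r₀ < ρ ∧ Bornology.IsBounded (rrrTube A B r₀)
    · obtain ⟨r₀, hr₀, hr₀ρ, hb⟩ := h
      obtain ⟨r, hr, hrr₀, hsub⟩ := exists_rrrTube_subset_thickening hA hB hMne hr₀ hδ hb
      exact ⟨r, hr, hrr₀.trans_lt hr₀ρ, fun _ => hsub⟩
    · exact ⟨ρ / 2, by positivity, by linarith, fun h' => absurd h' h⟩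
  refine ⟨r, σ, δ, hr, hrρ, hσ, hδ, hbdd, ?_, ?_⟩
  · intro I x _ hx t ht hxt
    have h := hest _ (Metric.thickening_mono (show δ ≤ η by linarith) _ hxt.2)
    exact ⟨_, hasDerivWithinAt_half_norm_rrrField_sq hx ht h.1, h.2.1⟩
  · intro x hx hx0
    have hstay : ∀ t : ℝ, 0 ≤ t → HasRRREstimates A B σ (x t) := fun t ht =>
      hest _ (forall_mem_thickening_of_isRRRSolutionOn hA hB hMne hσ hη hest hδη hδσ hx hx0.2 ht)
    have hdecay : ∀ t : ℝ, 0 ≤ t →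
        ‖rrrField A B (x t)‖ ≤ Real.exp (-σ * t) * ‖rrrField A B (x 0)‖ := fun t ht =>
      norm_rrrField_le_exp_of_forall_mem_Icc hx (fun s hs => hstay s hs.1) (right_mem_Icc.2 ht)
    refine ⟨hdecay, ?_⟩
    have hlim : Tendsto (fun t => Real.exp (-σ * t) * ‖rrrField A B (x 0)‖ / σ) atTop (𝓝 0) := by
      have h1 : Tendsto (fun t : ℝ => -σ * t) atTop atBot :=
        tendsto_id.const_mul_atTop_of_neg (by linarith)
      simpa using ((Real.tendsto_exp_atBot.comp h1).mul_const ‖rrrField A B (x 0)‖).div_const σ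
    refine squeeze_zero' (Eventually.of_forall fun t => Metric.infDist_nonneg) ?_ hlim
    filter_upwards [eventually_ge_atTop 0] with t ht
    rw [le_div_iff₀' hσ]
    exact (hstay t ht).2.2.trans (hdecay t ht)
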